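/- Let $\Phi$ be an irreducible (reduced, crystallographic) root system of rank $\ell$ in a Euclidean space $V=\mathbb R^\ell$ with inner product $(\cdot,\cdot)$, with Weyl group $W$ and Coxeter number $h$ (the order of a Coxeter element of $W$). Fix simple roots $\alpha_1,\dots,\alpha_\ell$, let $\widetilde\alpha=\sum_{i=1}^\ell c_i\alpha_i$ be the highest root, and put $\alpha_0=-\widetilde\alpha$, $c_0=1$. Let $Z^\vee=\{x\in V: (\alpha_i,x)\in\mathbb Z,\ 1\le i\le \ell\}$ be the coweight lattice, let $Q^\vee=\sum_{\alpha\in\Phi}\mathbb Z\,\frac{2\alpha}{(\alpha,\alpha)}$ be the coroot lattice, and let $f=[Z^\vee:Q^\vee]$. For $w\in W$ put $$\operatorname{asc}(w)=\sum_{0\le i\le \ell,\ w(\alpha_i)>0}c_i ,\qquad R_\Phi(t)=\frac1f\sum_{w\in W}t^{\operatorname{asc}(w)},$$ where $w(\alpha_i)>0$ means that $w(\alpha_i)$ is a positive root; $R_\Phi$ is the Lam–Postnikov generalized Eulerian polynomial. Let $\overline A=\{x\in V: (\alpha_i,x)\ge 0\ (1\le i\le \ell),\ (\widetilde\alpha,x)\le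 1\}$ be the closed fundamental alcove, and let $L_{\overline A}(n)=\#(n\overline A\cap Z^\vee)$ for integers $n\ge 0$, with $L_{\overline A}(n)=0$ for integers $n<0$. Let $S$ be the shift operator, $(Sg)(t)=g(t-1)$, so that $(P(S)g)(t)=\sum_k a_k\,g(t-k)$ for a polynomial $P(S)=\sum_k a_kS^k$. Then for every integer $q>h$, $$q^\ell=(R_\Phi(S)\,L_{\overline A})(q).$$ -/

import Mathlib

open scoped Pointwise

/-!
Throughout, an irreducible root system `Φ ⊂ V` is modelled by Mathlib's `RootPairing` over `ℝ`:
the roots are the vectors `P.root i` of `M`, the coroots and coweights live in `N`, and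
`P.root' i x` is the value `(α, x)` of the root `α = P.root i` at the vector `x`. (In a Euclidean
space one has `M = N = V`, with the inner product as the pairing.) A base `b` fixes the simple
roots `P.root i`, `i ∈ b.support`, and with them the positive roots.
-/

namespace Worpitzky

open Module

section Lattices

variable {ι M N : Type*} [AddCommGroup M] [Module ℝ M] [AddCommGroup N] [Module ℝ N]
  {P : RootPairing ι ℝ M N}

/-- The coweight lattice: all vectors on which every simple root takes an integral value. -/
def coweightLattice (b : P.Base) : AddSubgroup N where
  carrier := {x | ∀ i ∈ b.support, ∃ z : ℤ, P.root' i x = z}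
  zero_mem' := fun i _ => ⟨0, by simp⟩
  add_mem' := fun {x y} hx hy i hi => by
    obtain ⟨m, hm⟩ := hx i hi
    obtain ⟨n, hn⟩ := hy i hi
    exact ⟨m + n, by rw [map_add, hm, hn]; push_cast; rfl⟩
  neg_mem' := fun {x} hx i hi => by
    obtain ⟨m, hm⟩ := hx i hi
    exact ⟨-m, by rw [map_neg, hm]; push_cast; rfl⟩

/-- The coroot lattice: the additive group generated by the coroots. -/
def corootLattice (P : RootPairing ι ℝ M N) : AddSubgroup N :=
  AddSubgroup.closure (Set.range P.coroot)

/-- The index of connection `f`: the index of the coroot lattice in the coweight lattice. -/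
noncomputable def connectionIndex (b : P.Base) : ℕ :=
  (corootLattice P).relIndex (coweightLattice b)

/-- The Coxeter number `h`: the order in the Weyl group of a Coxeter element, that is, of a product
of all simple reflections (each taken once, in some order). -/
noncomputable def coxeterNumber (b : P.Base) : ℕ :=
  orderOf (b.support.toList.map (RootPairing.weylGroup.ofIdx P)).prod

/-- A vector is a positive root. -/
def IsPositiveRoot (b : P.Base) (v : M) : Prop :=
  ∃ j : ι, b.IsPos j ∧ P.root j = v

end Lattices

section Alcove

variable {ι M N : Type*} [Finite ι] [AddCommGroup M] [Module ℝ M] [AddCommGroup N] [Module ℝ N]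
  {P : RootPairing ι ℝ M N} [P.IsRootSystem] [P.IsIrreducible]

theorem exists_forall_height_le (b : P.Base) : ∃ i : ι, ∀ j : ι, b.height j ≤ b.height i := by
  have hM : Nontrivial M := RootPairing.IsIrreducible.nontrivial P
  have hne : Nonempty ι := by
    by_contra hι
    rw [not_nonempty_iff] at hι
    have h := RootPairing.IsRootSystem.span_root_eq_top (P := P)
    rw [Set.range_eq_empty, Submodule.span_empty] at h
    exact bot_ne_top h
  exact Finite.exists_max b.height

/-- The (index of the) highest root: the root of greatest height. -/
noncomputable def highestRoot (b : P.Base) : ι :=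
  (exists_forall_height_le b).choose

/-- The coefficient `c i` of the simple root `i` in the expansion of the highest root in simple
roots. It is a nonnegative integer; `highestRoot_eq_sum_mark` below is the expansion. -/
noncomputable def mark (b : P.Base) (i : b.support) : ℕ :=
  (b.toWeightBasisInt.repr (P.rootSpanMem ℤ (highestRoot b)) i).toNat

/-- The defining expansion of the highest root in simple roots, with the `mark b i` as
coefficients. -/
theorem highestRoot_eq_sum_mark (b : P.Base) :
    P.root (highestRoot b) = ∑ i : b.support, mark b i • P.root i := by
  let _ := P.indexNeg
  have hmax := (exists_forall_height_le b).choose_spec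
  change ∀ j, b.height j ≤ b.height (highestRoot b) at hmax
  have hpos : 0 < b.height (highestRoot b) := by
    have h1 := hmax (-highestRoot b)
    rw [b.height_reflectionPerm_self] at h1
    have h2 := b.height_ne_zero (highestRoot b)
    omega
  obtain ⟨g, -, hg | hg⟩ := b.exists_root_eq_sum_nat_or_neg (highestRoot b)
  · have key : P.rootSpanMem ℤ (highestRoot b) =
        ∑ i : b.support, (g i : ℤ) • b.toWeightBasisInt i := by
      apply Subtype.ext
      simp only [Submodule.coe_sum, hg]
      rw [← Finset.sum_coe_sort b.support (fun j => g j • P.root j)]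
      refine Finset.sum_congr rfl fun i _ => ?_
      change g i • P.root i = (g i : ℤ) • (b.toWeightBasisInt i : M)
      rw [natCast_zsmul, RootPairing.Base.coe_toWeightBasisInt_apply]
    have hm : ∀ i : b.support, mark b i = g i := by
      intro i
      rw [mark, key, Module.Basis.repr_sum_self]
      simp
    rw [hg]
    simp only [hm]
    exact (Finset.sum_coe_sort b.support (fun j => g j • P.root j)).symm
  · exfalso
    have h1 : P.root (highestRoot b) = ∑ j ∈ b.support, (fun j => -(g j : ℤ)) j • P.root j := by
      rw [hg]
      simp
    rw [RootPairing.Base.height_eq_sum h1] at hpos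
    have h2 : ∑ j ∈ b.support, -(g j : ℤ) ≤ 0 :=
      Finset.sum_nonpos fun j _ => by omega
    omega

/-- The simple roots together with `α₀ = -(highest root)`, which has the index `none`. -/
noncomputable def affineSimpleRoot (b : P.Base) : Option b.support → M
  | none => -P.root (highestRoot b)
  | some i => P.root i

/-- The coefficients `c₀ = 1` and `c i` of the relation `∑ i, c i • α i = 0` between the vectors
`affineSimpleRoot b i`. -/
noncomputable def affineMark (b : P.Base) : Option b.support → ℕ
  | none => 1
  | some i => mark b i

/-- The Weyl group is finite: its elements are determined by their action on the roots. -/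
instance finite_weylGroup : Finite P.weylGroup := by
  refine Finite.of_injective (fun w : P.weylGroup => P.weylGroupToPerm w) fun w₁ w₂ h => ?_
  apply Subtype.ext
  apply RootPairing.Equiv.weightHom_injective P
  apply LinearEquiv.toLinearMap_injective
  refine LinearMap.ext_on_range (RootPairing.IsRootSystem.span_root_eq_top (P := P)) fun i => ?_
  change w₁ • P.root i = w₂ • P.root i
  rw [RootPairing.weylGroup_apply_root, RootPairing.weylGroup_apply_root]
  exact congrArg (fun e : ι ≃ ι => P.root (e i)) h

open Classical in
/-- `asc w` is the sum of the `c i` over those `0 ≤ i ≤ ℓ` for which `w (α i)` is a positive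
root. -/
noncomputable def asc (b : P.Base) (w : P.weylGroup) : ℕ :=
  ∑ i : Option b.support, if IsPositiveRoot b (w • affineSimpleRoot b i) then affineMark b i else 0

/-- The generalized Eulerian polynomial `(1 / f) * ∑ t ^ asc w`, the sum being over the (finite)
Weyl group. -/
noncomputable def generalizedEulerian (b : P.Base) : Polynomial ℚ :=
  Polynomial.C ((connectionIndex b : ℚ)⁻¹) * ∑ᶠ w : P.weylGroup, Polynomial.X ^ asc b w

/-- The closed fundamental alcove. -/
def closedAlcove (b : P.Base) : Set N :=
  {x | (∀ i ∈ b.support, 0 ≤ P.root' i x) ∧ P.root' (highestRoot b) x ≤ 1}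

/-- The Ehrhart counting function of the closed fundamental alcove with respect to the coweight
lattice: the number of points of the coweight lattice in the dilated alcove, for a dilation factor
`n ≥ 0`. It is extended by `0` to negative integers `n`. -/
noncomputable def ehrhart (b : P.Base) (n : ℤ) : ℚ :=
  if 0 ≤ n then (((n : ℝ) • closedAlcove b ∩ (coweightLattice b : Set N)).ncard : ℚ) else 0

end Alcove

/-- The shift operator `(S f) t = f (t - 1)`. For a polynomial `p = ∑ a k * X ^ k`, the operator
`p(S)` is `Polynomial.aeval shift p`, so that `(p(S) f) t = ∑ a k * f (t - k)`; see
`aeval_shift_apply`. -/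
def shift : Module.End ℚ (ℤ → ℚ) := LinearMap.funLeft ℚ ℚ (fun t : ℤ => t - 1)

theorem shift_pow_apply (k : ℕ) (f : ℤ → ℚ) (t : ℤ) : (shift ^ k) f t = f (t - k) := by
  induction k generalizing t with
  | zero => simp
  | succ k ih =>
    rw [pow_succ', Module.End.mul_apply]
    change (shift ^ k) f (t - 1) = _
    rw [ih]
    push_cast
    congr 1
    ring

theorem aeval_shift_apply (p : Polynomial ℚ) (f : ℤ → ℚ) (t : ℤ) :
    Polynomial.aeval shift p f t = p.sum fun k a => a * f (t - k) := by
  rw [Polynomial.aeval_eq_sum_range, Polynomial.sum_over_range _ (by simp)]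
  simp [LinearMap.sum_apply, Finset.sum_apply, shift_pow_apply]

end Worpitzky

/-! Write Z for the coweight lattice, Q for the coroot lattice, θ for the highest root. The
identity, multiplied by f, counts Z/nQ in two ways, for n = q. The tower nQ ≤ nZ ≤ Z gives f * n ^ ℓ
classes (`relIndex_nsmul_corootLattice`).

For the other count, attach to each w in W a half-open alcove of size n: the closed one with the
wall of αᵢ removed whenever w αᵢ > 0. Sending a lattice point x of the half-open alcove of w to the
class of w x is a bijection onto Z/nQ (`bijective_mk_coweightAction`). Since the barycentric
coordinates, weighted by the cᵢ, sum to n, a translation that removes the strict inequalities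
shrinks the alcove by exactly asc w. So w contributes L(n - asc w) (`ncard_latticePoints_ascents`),
and summing over w gives R(S) L up to the factor f.

The bijection comes from a perturbation. Let d have value 1 on all simple roots and let k = ht θ +
1. Then x lies in the half-open alcove of w iff k x - w⁻¹ d lies in the open alcove of size k n
(`mem_latticePoints_ascents_iff`): root values change by heights, which are nonzero and smaller than
k in absolute value. On such regular points the affine group W ⋉ knQ has the open alcove as a
fundamental domain: `affine_eq_one_of_mem_alcove` gives uniqueness, and `exists_affine_mem_alcove`
gives existence by minimizing the distance to d over an orbit. -/

namespace Worpitzky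

open Module

/-! ### The Weyl group acting on coweights and on the two lattices. -/

section Action

variable {ι M N : Type*} [AddCommGroup M] [Module ℝ M] [AddCommGroup N] [Module ℝ N]
  {P : RootPairing ι ℝ M N}

/-- The (left) action of the Weyl group on coweights. -/
noncomputable def coweightAction (P : RootPairing ι ℝ M N) : P.weylGroup →* (N ≃ₗ[ℝ] N) where
  -- Coweight maps compose contravariantly; the inverse turns this into a left action.
  toFun w := RootPairing.Equiv.coweightEquiv P P ((w⁻¹ : P.weylGroup) : P.Aut)
  map_one' := by
    ext x
    simp
  map_mul' u w := by
    ext x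
    simp

theorem root'_coweightAction (w : P.weylGroup) (i : ι) (x : N) :
    P.root' i (coweightAction P w x) = P.root' (P.weylGroupToPerm w⁻¹ i) x := by
  have h := LinearMap.congr_fun₂ (((w⁻¹ : P.weylGroup) : P.Aut).weight_coweight_transpose) x
    (P.root i)
  have h2 := P.weylGroup_apply_root w⁻¹ i
  rw [RootPairing.root', RootPairing.root', ← h2]
  exact h.symm

theorem root'_weylGroupToPerm (w : P.weylGroup) (i : ι) (x : N) :
    P.root' (P.weylGroupToPerm w i) x = P.root' i (coweightAction P w⁻¹ x) := by
  rw [root'_coweightAction, inv_inv]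

theorem coweightAction_coroot (w : P.weylGroup) (i : ι) :
    coweightAction P w (P.coroot i) = P.coroot (P.weylGroupToPerm w i) := by
  have h := congrFun (((w⁻¹ : P.weylGroup) : P.Aut).coroot_coweightMap) i
  exact h

theorem coweightAction_ofIdx (i : ι) (x : N) :
    coweightAction P (RootPairing.weylGroup.ofIdx P i) x = x - P.root' i x • P.coroot i := by
  change RootPairing.Equiv.coweightEquiv P P ((RootPairing.Equiv.reflection P i)⁻¹) x = _
  rw [RootPairing.Equiv.reflection_inv, RootPairing.Equiv.reflection_coweightEquiv,
    RootPairing.coreflection_apply]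

theorem coweightAction_injective : Function.Injective (coweightAction P) := by
  intro u w h
  have h1 : RootPairing.Equiv.coweightHom P ((u⁻¹ : P.weylGroup) : P.Aut) =
      RootPairing.Equiv.coweightHom P ((w⁻¹ : P.weylGroup) : P.Aut) := congrArg MulOpposite.op h
  exact inv_injective (Subtype.ext (RootPairing.Equiv.coweightHom_injective P h1))

theorem weylGroupToPerm_ofIdx (i j : ι) :
    P.weylGroupToPerm (RootPairing.weylGroup.ofIdx P i) j = P.reflectionPerm i j := rfl

/-- Conjugating a reflection gives the reflection in the image root. -/
theorem conj_ofIdx (w : P.weylGroup) (i : ι) :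
    w * RootPairing.weylGroup.ofIdx P i * w⁻¹ =
      RootPairing.weylGroup.ofIdx P (P.weylGroupToPerm w i) := by
  apply coweightAction_injective
  ext x
  simp only [map_mul, LinearEquiv.mul_apply, coweightAction_ofIdx, map_sub, map_smul,
    coweightAction_coroot, root'_weylGroupToPerm]
  rw [← LinearEquiv.mul_apply, ← map_mul, mul_inv_cancel, map_one]
  rfl

theorem ofIdx_mul_self (i : ι) :
    RootPairing.weylGroup.ofIdx P i * RootPairing.weylGroup.ofIdx P i = 1 := by
  have h : (RootPairing.weylGroup.ofIdx P i)⁻¹ = RootPairing.weylGroup.ofIdx P i :=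
    Subtype.ext (RootPairing.Equiv.reflection_inv P i)
  rw [← inv_mul_cancel (RootPairing.weylGroup.ofIdx P i), h]

theorem ofIdx_reflectionPerm (i j : ι) :
    RootPairing.weylGroup.ofIdx P (P.reflectionPerm i j) =
      RootPairing.weylGroup.ofIdx P i * RootPairing.weylGroup.ofIdx P j *
        RootPairing.weylGroup.ofIdx P i := by
  rw [← weylGroupToPerm_ofIdx, ← conj_ofIdx, eq_inv_of_mul_eq_one_left (ofIdx_mul_self i), inv_inv,
    ← eq_inv_of_mul_eq_one_left (ofIdx_mul_self i)]

theorem coweightAction_mem_corootLattice (w : P.weylGroup) {x : N} (hx : x ∈ corootLattice P) :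
    coweightAction P w x ∈ corootLattice P := by
  induction hx using AddSubgroup.closure_induction with
  | mem x hx =>
    obtain ⟨i, rfl⟩ := hx
    rw [coweightAction_coroot]
    exact AddSubgroup.subset_closure ⟨_, rfl⟩
  | zero => simp
  | add x y _ _ hx hy => rw [map_add]; exact add_mem hx hy
  | neg x _ hx => rw [map_neg]; exact neg_mem hx

theorem coroot_mem_corootLattice (P : RootPairing ι ℝ M N) (i : ι) :
    P.coroot i ∈ corootLattice P := AddSubgroup.subset_closure ⟨i, rfl⟩

theorem exists_root'_eq_intCast [P.IsCrystallographic] {x : N} (hx : x ∈ corootLattice P) (i : ι) :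
    ∃ k : ℤ, P.root' i x = k := by
  induction hx using AddSubgroup.closure_induction with
  | mem x hx =>
    obtain ⟨j, rfl⟩ := hx
    exact ⟨P.pairingIn ℤ i j, (P.algebraMap_pairingIn ℤ i j).symm⟩
  | zero => exact ⟨0, by simp⟩
  | add x y _ _ hx hy =>
    obtain ⟨k, hk⟩ := hx
    obtain ⟨l, hl⟩ := hy
    exact ⟨k + l, by rw [map_add, hk, hl]; push_cast; rfl⟩
  | neg x _ hx =>
    obtain ⟨k, hk⟩ := hx
    exact ⟨-k, by rw [map_neg, hk]; push_cast; rfl⟩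

theorem corootLattice_le_coweightLattice [P.IsCrystallographic] (b : P.Base) :
    corootLattice P ≤ coweightLattice b := fun _ hx i _ => exists_root'_eq_intCast hx i

/-- Every root is an integral combination of simple roots. This makes the coweight lattice stable
under the Weyl group. -/
theorem exists_root'_eq_intCast_of_mem_coweightLattice {b : P.Base} {x : N}
    (hx : x ∈ coweightLattice b) (i : ι) : ∃ k : ℤ, P.root' i x = k := by
  have h : P.root i ∈ AddSubgroup.closure (P.root '' b.support) := by
    obtain ⟨f, -, h | h⟩ := b.exists_root_eq_sum_nat_or_neg i
    all_goals rw [h]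
    · exact sum_mem fun j hj => nsmul_mem (AddSubgroup.subset_closure (Set.mem_image_of_mem _ hj)) _
    · exact neg_mem (sum_mem fun j hj => nsmul_mem (AddSubgroup.subset_closure (Set.mem_image_of_mem _ hj)) _)
  suffices ∀ m ∈ AddSubgroup.closure (P.root '' b.support), ∃ k : ℤ, P.toLinearMap m x = k from
    this _ h
  intro m hm
  induction hm using AddSubgroup.closure_induction with
  | mem m hm =>
    obtain ⟨j, hj, rfl⟩ := hm
    exact hx j hj
  | zero => exact ⟨0, by simp⟩
  | add x y _ _ hx hy =>
    obtain ⟨k, hk⟩ := hx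
    obtain ⟨l, hl⟩ := hy
    exact ⟨k + l, by rw [map_add, LinearMap.add_apply, hk, hl]; push_cast; rfl⟩
  | neg x _ hx =>
    obtain ⟨k, hk⟩ := hx
    exact ⟨-k, by rw [map_neg, LinearMap.neg_apply, hk]; push_cast; rfl⟩

theorem coweightAction_mem_coweightLattice {b : P.Base} (w : P.weylGroup) {x : N}
    (hx : x ∈ coweightLattice b) : coweightAction P w x ∈ coweightLattice b := by
  intro i _
  rw [root'_coweightAction]
  exact exists_root'_eq_intCast_of_mem_coweightLattice hx _

end Action

/-! ### Words in simple reflections and faithfulness of the action on positive roots. -/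

section FiniteWeylGroup

variable {ι M N : Type*} [Finite ι] [AddCommGroup M] [Module ℝ M] [AddCommGroup N] [Module ℝ N]
  {P : RootPairing ι ℝ M N} [P.IsCrystallographic] [P.IsReduced]

/-- The product of the reflections in a word of roots. -/
noncomputable def reflectionWord (P : RootPairing ι ℝ M N) (l : List ι) : P.weylGroup :=
  (l.map (RootPairing.weylGroup.ofIdx P)).prod

theorem exists_reflectionWord_eq_ofIdx (b : P.Base) (i : ι) :
    ∃ l : List ι, (∀ j ∈ l, j ∈ b.support) ∧
      reflectionWord P l = RootPairing.weylGroup.ofIdx P i := by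
  refine b.induction_reflect i (p := fun i => ∃ l : List ι, (∀ j ∈ l, j ∈ b.support) ∧
    reflectionWord P l = RootPairing.weylGroup.ofIdx P i) ?_ ?_ ?_
  · rintro i ⟨l, hl, h⟩
    refine ⟨l, hl, ?_⟩
    rw [h, ofIdx_reflectionPerm, ofIdx_mul_self, one_mul]
  · intro i hi
    exact ⟨[i], by simpa using hi, by simp [reflectionWord]⟩
  · rintro i j ⟨l, hl, h⟩ hj
    refine ⟨[j] ++ l ++ [j], ?_, ?_⟩
    · intro k hk
      simp only [List.mem_append, List.mem_singleton] at hk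
      rcases hk with (rfl | hk) | rfl
      exacts [hj, hl k hk, hj]
    · rw [ofIdx_reflectionPerm, ← h]
      simp [reflectionWord, mul_assoc]

/-- The Weyl group is generated by the simple reflections. -/
theorem exists_reflectionWord_eq (b : P.Base) (w : P.weylGroup) :
    ∃ l : List ι, (∀ j ∈ l, j ∈ b.support) ∧ reflectionWord P l = w := by
  obtain ⟨w, hw⟩ := w
  induction hw using RootPairing.weylGroup.induction with
  | mem i => exact exists_reflectionWord_eq_ofIdx b i
  | one => exact ⟨[], by simp, rfl⟩
  | mul x y hx hy hx' hy' =>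
    obtain ⟨l, hl, h⟩ := hx'
    obtain ⟨k, hk, h'⟩ := hy'
    refine ⟨l ++ k, ?_, ?_⟩
    · intro j hj
      rcases List.mem_append.mp hj with hj | hj
      exacts [hl j hj, hk j hj]
    · rw [reflectionWord, List.map_append, List.prod_append]
      change reflectionWord P l * reflectionWord P k = _
      rw [h, h']
      rfl

/-- The exchange condition. -/
theorem exists_reflectionWord_mul_eq (b : P.Base) (l : List ι) (hl : ∀ j ∈ l, j ∈ b.support)
    {i : ι} (hi : i ∈ b.support) (hneg : ¬ b.IsPos (P.weylGroupToPerm (reflectionWord P l) i)) :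
    ∃ k : List ι, (∀ j ∈ k, j ∈ b.support) ∧ k.length < l.length ∧
      reflectionWord P l * RootPairing.weylGroup.ofIdx P i = reflectionWord P k := by
  induction l with
  | nil => exact absurd (RootPairing.Base.isPos_of_mem_support hi) hneg
  | cons a t ih =>
    have ha : a ∈ b.support := hl a (by simp)
    have ht : ∀ j ∈ t, j ∈ b.support := fun j hj => hl j (by simp [hj])
    have hcons (t : List ι) : reflectionWord P (a :: t) =
        RootPairing.weylGroup.ofIdx P a * reflectionWord P t := by simp [reflectionWord]
    by_cases hpos : b.IsPos (P.weylGroupToPerm (reflectionWord P t) i)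
    · refine ⟨t, ht, by simp, ?_⟩
      -- The simple reflection in `a` makes only one positive root negative, namely `a` itself.
      -- Conjugation then cancels the letter `a` against the new reflection.
      have hai : P.weylGroupToPerm (reflectionWord P t) i = a := by
        by_contra hne
        exact hneg (hcons t ▸ hpos.reflectionPerm ha hne)
      rw [hcons, ← hai, ← conj_ofIdx]
      simp only [mul_assoc, inv_mul_cancel_left]
      rw [ofIdx_mul_self, mul_one]
    · obtain ⟨k, hk, hlen, h⟩ := ih ht hpos
      refine ⟨a :: k, ?_, by simpa using hlen, ?_⟩
      · intro j hj
        rcases List.mem_cons.mp hj with rfl | hj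
        exacts [ha, hk j hj]
      · rw [hcons, hcons, mul_assoc, h]

/-- An element of the Weyl group that preserves the positive roots is trivial. -/
theorem eq_one_of_forall_isPos (b : P.Base) (w : P.weylGroup)
    (hw : ∀ i, b.IsPos i → b.IsPos (P.weylGroupToPerm w i)) : w = 1 := by
  obtain ⟨l, hl, rfl⟩ := exists_reflectionWord_eq b w
  induction hn : l.length using Nat.strong_induction_on generalizing l with
  | _ n ih =>
    rcases List.eq_nil_or_concat l with rfl | ⟨t, i, rfl⟩
    · rfl
    have hi : i ∈ b.support := hl i (by simp)
    have ht : ∀ j ∈ t, j ∈ b.support := fun j hj => hl j (by simp [hj])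
    have hconcat : reflectionWord P (t.concat i) =
        reflectionWord P t * RootPairing.weylGroup.ofIdx P i := by simp [reflectionWord]
    -- The full word sends root `i` to the negative of its image under `t`, and that value is
    -- positive by `hw`. Exchange then gives a shorter word for the same element.
    have hneg : ¬ b.IsPos (P.weylGroupToPerm (reflectionWord P t) i) := by
      let _ := P.indexNeg
      intro hpos
      have h := hw i (RootPairing.Base.isPos_of_mem_support hi)
      rw [hconcat, map_mul, Equiv.Perm.mul_apply, weylGroupToPerm_ofIdx] at h
      have h3 : P.root (P.weylGroupToPerm (reflectionWord P t) (P.reflectionPerm i i)) =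
          P.root (-(P.weylGroupToPerm (reflectionWord P t) i)) := by
        rw [← P.weylGroup_apply_root, RootPairing.indexNeg_neg, RootPairing.root_reflectionPerm,
          RootPairing.reflection_apply_self, RootPairing.root_reflectionPerm,
          RootPairing.reflection_apply_self, ← P.weylGroup_apply_root]
        exact smul_neg (reflectionWord P t : P.Aut) (P.root i)
      rw [P.root.injective h3, RootPairing.Base.IsPos.neg_iff_not] at h
      exact h hpos
    obtain ⟨k, hk, hlen, h⟩ := exists_reflectionWord_mul_eq b t ht hi hneg
    rw [hconcat, h]
    refine ih k.length ?_ k hk ?_ rfl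
    · simp only [List.length_concat] at hn
      omega
    · rw [← h, ← hconcat]
      exact hw

end FiniteWeylGroup

/-! ### Positive roots, heights and values on dominant vectors. -/

section Positivity

variable {ι M N : Type*} [AddCommGroup M] [Module ℝ M] [AddCommGroup N] [Module ℝ N]
  {P : RootPairing ι ℝ M N} {b : P.Base}

theorem root'_eq_sum {i : ι} {f : ι → ℕ} (h : P.root i = ∑ j ∈ b.support, f j • P.root j) (x : N) :
    P.root' i x = ∑ j ∈ b.support, f j * P.root' j x := by
  rw [RootPairing.root', h]
  simp [LinearMap.sum_apply]

theorem exists_root_eq_sum_nat_of_isPos {i : ι} (hi : b.IsPos i) :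
    ∃ f : ι → ℕ, P.root i = ∑ j ∈ b.support, f j • P.root j ∧ 0 < ∑ j ∈ b.support, f j := by
  rw [RootPairing.Base.isPos_iff] at hi
  obtain ⟨f, -, h | h⟩ := b.exists_root_eq_sum_nat_or_neg i
  · refine ⟨f, h, ?_⟩
    have h1 : P.root i = ∑ j ∈ b.support, (f j : ℤ) • P.root j := by simpa using h
    rw [RootPairing.Base.height_eq_sum h1] at hi
    exact_mod_cast hi
  · have h1 : P.root i = ∑ j ∈ b.support, (-(f j : ℤ)) • P.root j := by simpa using h
    rw [RootPairing.Base.height_eq_sum h1, Finset.sum_neg_distrib] at hi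
    have : 0 ≤ ∑ j ∈ b.support, (f j : ℤ) := by positivity
    omega

theorem root'_nonneg_of_isPos {i : ι} (hi : b.IsPos i) {x : N}
    (hx : ∀ j ∈ b.support, 0 ≤ P.root' j x) : 0 ≤ P.root' i x := by
  obtain ⟨f, hf, -⟩ := exists_root_eq_sum_nat_of_isPos hi
  rw [root'_eq_sum hf]
  exact Finset.sum_nonneg fun j hj => mul_nonneg (Nat.cast_nonneg _) (hx j hj)

theorem root'_pos_of_isPos {i : ι} (hi : b.IsPos i) {x : N}
    (hx : ∀ j ∈ b.support, 0 < P.root' j x) : 0 < P.root' i x := by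
  obtain ⟨f, hf, hf'⟩ := exists_root_eq_sum_nat_of_isPos hi
  rw [root'_eq_sum hf]
  obtain ⟨j, hj, hfj⟩ := Finset.sum_pos_iff.mp hf'
  exact Finset.sum_pos' (fun j hj => mul_nonneg (Nat.cast_nonneg _) (hx j hj).le)
    ⟨j, hj, mul_pos (Nat.cast_pos.mpr hfj) (hx j hj)⟩

theorem root'_reflectionPerm_self (i : ι) (x : N) :
    P.root' (P.reflectionPerm i i) x = -P.root' i x := by
  rw [RootPairing.root', RootPairing.root_reflectionPerm, RootPairing.reflection_apply_self,
    map_neg, LinearMap.neg_apply]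

theorem isPos_or_isPos_reflectionPerm (b : P.Base) (i : ι) :
    b.IsPos i ∨ b.IsPos (P.reflectionPerm i i) := by
  let _ := P.indexNeg
  exact RootPairing.Base.IsPos.or_neg b i

theorem not_isPos_reflectionPerm {i : ι} (hi : b.IsPos i) : ¬ b.IsPos (P.reflectionPerm i i) := by
  let _ := P.indexNeg
  intro h
  exact (RootPairing.Base.IsPos.neg_iff_not b i).mp h hi

theorem isPos_iff_root'_pos {x : N} (hx : ∀ j ∈ b.support, 0 < P.root' j x) (i : ι) :
    b.IsPos i ↔ 0 < P.root' i x := by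
  refine ⟨fun hi => root'_pos_of_isPos hi hx, fun h => ?_⟩
  refine (isPos_or_isPos_reflectionPerm b i).resolve_right fun hi => ?_
  have := root'_pos_of_isPos hi hx
  rw [root'_reflectionPerm_self] at this
  linarith

theorem root'_eq_height {x : N} (hx : ∀ j ∈ b.support, P.root' j x = 1) (i : ι) :
    P.root' i x = b.height i := by
  obtain ⟨f, -, -, h⟩ := b.exists_root_eq_sum_int i
  rw [RootPairing.Base.height_eq_sum h, RootPairing.root', h]
  simp only [map_sum, map_zsmul, LinearMap.sum_apply, LinearMap.smul_apply]
  push_cast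
  refine Finset.sum_congr rfl fun j hj => ?_
  have h1 : P.toLinearMap (P.root j) x = 1 := hx j hj
  rw [h1]
  simp

theorem height_add_simple {i j k : ι} (hj : j ∈ b.support)
    (hk : P.root k = P.root i + P.root j) : b.height k = b.height i + 1 := by
  rw [RootPairing.Base.height_add b hk, b.height_one_of_mem_support hj]

end Positivity

/-! ### Positivity of the marks and dominance of the highest root. -/

section HighestRoot

variable {ι M N : Type*} [Finite ι] [AddCommGroup M] [Module ℝ M] [AddCommGroup N] [Module ℝ N]
  {P : RootPairing ι ℝ M N} [P.IsRootSystem] [P.IsIrreducible]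

theorem height_le_height_highestRoot (b : P.Base) (i : ι) : b.height i ≤ b.height (highestRoot b) :=
  (exists_forall_height_le b).choose_spec i

theorem isPos_highestRoot (b : P.Base) : b.IsPos (highestRoot b) := by
  have h0 := height_le_height_highestRoot b (highestRoot b)
  refine (isPos_or_isPos_reflectionPerm b (highestRoot b)).resolve_right fun h => ?_
  have h1 := height_le_height_highestRoot b (P.reflectionPerm (highestRoot b) (highestRoot b))
  have h2 := (not_isPos_reflectionPerm (b := b) (i := highestRoot b)).mt (not_not.mpr h)
  rw [RootPairing.Base.isPos_iff] at h h2
  omega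

theorem root'_highestRoot (b : P.Base) (x : N) :
    P.root' (highestRoot b) x = ∑ i : b.support, mark b i * P.root' i x := by
  rw [RootPairing.root', highestRoot_eq_sum_mark]
  simp [LinearMap.sum_apply]

variable [P.IsCrystallographic] [P.IsReduced]

omit [P.IsRootSystem] [P.IsIrreducible] [P.IsReduced] in
/-- A positive root whose sum with a simple root is not a root pairs nonnegatively with the
simple coroot. -/
theorem pairingIn_nonneg_of_forall_add_notMem {b : P.Base} {i j : ι} (hi : b.IsPos i)
    (hj : j ∈ b.support) (h : P.root i + P.root j ∉ Set.range P.root) :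
    0 ≤ P.pairingIn ℤ i j := by
  by_contra! hlt
  refine h (P.root_add_root_mem_of_pairingIn_neg hlt fun heq => ?_)
  have : i = P.reflectionPerm j j := by
    apply P.root.injective
    rw [heq, RootPairing.root_reflectionPerm, RootPairing.reflection_apply_self]
  rw [this] at hi
  exact not_isPos_reflectionPerm (RootPairing.Base.isPos_of_mem_support hj) hi

-- A negative pairing would make θ + αⱼ a root of greater height.
omit [P.IsReduced] in
theorem pairingIn_highestRoot_nonneg (b : P.Base) {j : ι} (hj : j ∈ b.support) :
    0 ≤ P.pairingIn ℤ (highestRoot b) j := by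
  refine pairingIn_nonneg_of_forall_add_notMem (isPos_highestRoot b) hj ?_
  rintro ⟨k, hk⟩
  have h1 := height_le_height_highestRoot b k
  rw [height_add_simple hj hk] at h1
  omega

omit [P.IsCrystallographic] [P.IsReduced] in
theorem pairing_highestRoot (b : P.Base) (j : ι) :
    P.pairing (highestRoot b) j = ∑ i : b.support, mark b i * P.pairing i j :=
  root'_highestRoot b (P.coroot j)

/-- All coefficients of the highest root are positive. -/
theorem mark_pos (b : P.Base) (i : b.support) : 0 < mark b i := by
  -- The span `q` of the simple roots in the support of θ turns out to be invariant under all simple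
  -- reflections; irreducibility then forces it to be everything.
  let J : Set b.support := {i | 0 < mark b i}
  let q : Submodule ℝ M := Submodule.span ℝ ((fun i : b.support => P.root i) '' J)
  -- For j outside the support, the pairing of θ with the coroot of j is nonnegative, yet it is a
  -- sum of nonpositive terms; so each term vanishes.
  have horth : ∀ j : b.support, j ∉ J → ∀ i ∈ J, P.pairing i j = 0 := by
    intro j hj
    have hj0 : mark b j = 0 := by simpa [J] using hj
    have hnonpos : ∀ i : b.support, (mark b i : ℝ) * P.pairing i j ≤ 0 := by
      intro i
      by_cases hij : i = j
      · subst hij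
        simp [hj0]
      · refine mul_nonpos_of_nonneg_of_nonpos (Nat.cast_nonneg _) ?_
        rw [← P.algebraMap_pairingIn ℤ]
        have := b.pairingIn_le_zero_of_ne (i := i) (j := j) (fun h => hij (Subtype.ext h))
          i.2 j.2
        simpa using this
    have hsum : ∑ i : b.support, (mark b i : ℝ) * P.pairing i j = 0 := by
      refine le_antisymm (Finset.sum_nonpos fun i _ => hnonpos i) ?_
      rw [← pairing_highestRoot, ← P.algebraMap_pairingIn ℤ]
      simpa using pairingIn_highestRoot_nonneg b j.2
    intro i hi
    have h := (Finset.sum_eq_zero_iff_of_nonpos fun i _ => hnonpos i).mp hsum i (Finset.mem_univ _)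
    have hi' : (mark b i : ℝ) ≠ 0 := by
      have : 0 < mark b i := hi
      positivity
    exact (mul_eq_zero.mp h).resolve_left hi'
  have hinv : ∀ j ∈ b.support, q ∈ Module.End.invtSubmodule (P.reflection j).toLinearMap := by
    intro j hj
    rw [Module.End.mem_invtSubmodule]
    refine Submodule.span_le.mpr ?_
    rintro _ ⟨i, hi, rfl⟩
    change P.reflection j (P.root i) ∈ q
    rw [RootPairing.reflection_apply_root]
    have hiq : P.root i ∈ q := Submodule.subset_span ⟨i, hi, rfl⟩
    by_cases hjJ : (⟨j, hj⟩ : b.support) ∈ J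
    · exact sub_mem hiq (Submodule.smul_mem _ _ (Submodule.subset_span ⟨⟨j, hj⟩, hjJ, rfl⟩))
    · rw [horth ⟨j, hj⟩ hjJ i hi, zero_smul, sub_zero]
      exact hiq
  have hne : q ≠ ⊥ := by
    have hex : ∃ i, i ∈ J := by
      by_contra! hcon
      have h0 : ∀ i, mark b i = 0 := fun i => by simpa [J] using hcon i
      apply P.ne_zero (highestRoot b)
      rw [highestRoot_eq_sum_mark]
      simp [h0]
    obtain ⟨i, hi⟩ := hex
    intro h
    have hiq : P.root i ∈ q := Submodule.subset_span ⟨i, hi, rfl⟩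
    rw [h, Submodule.mem_bot] at hiq
    exact P.ne_zero _ hiq
  have htop : q = ⊤ := RootPairing.IsIrreducible.eq_top_of_invtSubmodule_reflection q
    ((b.forall_mem_support_invtSubmodule_iff q).mp hinv) hne
  have hmem : b.toWeightBasis i ∈ Submodule.span ℝ (b.toWeightBasis '' J) := by
    have : (b.toWeightBasis '' J) = (fun i : b.support => P.root i) '' J := by
      refine Set.image_congr fun j _ => ?_
      exact b.toWeightBasis_apply j
    rw [this]
    change _ ∈ q
    rw [htop]
    trivial
  exact b.toWeightBasis.self_mem_span_image.mp hmem

/-- The highest root dominates all roots on the dominant chamber. -/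
theorem root'_le_root'_highestRoot (b : P.Base) (i : ι) {x : N}
    (hx : ∀ j ∈ b.support, 0 ≤ P.root' j x) : P.root' i x ≤ P.root' (highestRoot b) x := by
  have := Fintype.ofFinite ι
  rcases isPos_or_isPos_reflectionPerm b i with hi | hi
  swap
  · have h1 := root'_nonneg_of_isPos hi hx
    have h2 := root'_nonneg_of_isPos (isPos_highestRoot b) hx
    rw [root'_reflectionPerm_self] at h1
    linarith
  -- Among the positive roots with value at `x` at least that of `i`, take one of greatest height.
  -- Adding a simple root never lowers the value, so `k` is dominant; it remains to identify it with
  -- θ.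
  obtain ⟨k, ⟨hk, hkx⟩, hmax⟩ := Set.exists_max_image
    {k | b.IsPos k ∧ P.root' i x ≤ P.root' k x} b.height (Set.toFinite _) ⟨i, hi, le_rfl⟩
  have hdom : ∀ j ∈ b.support, 0 ≤ P.pairingIn ℤ k j := by
    intro j hj
    refine pairingIn_nonneg_of_forall_add_notMem hk hj ?_
    rintro ⟨l, hl⟩
    have hlpos : b.IsPos l := RootPairing.Base.IsPos.add hk
      (RootPairing.Base.isPos_of_mem_support hj) hl
    have hlx : P.root' l x = P.root' k x + P.root' j x := by
      rw [RootPairing.root', hl, map_add, LinearMap.add_apply]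
    have h1 := hmax l ⟨hlpos, by rw [hlx]; linarith [hx j hj]⟩
    rw [height_add_simple hj hl] at h1
    omega
  suffices k = highestRoot b from this ▸ hkx
  by_contra hne
  have hpair : 0 < P.pairingIn ℤ (highestRoot b) k := by
    have hnonneg : ∀ j : b.support, 0 ≤ P.pairing j k := by
      intro j
      rw [← P.algebraMap_pairingIn ℤ]
      have h1 := hdom j j.2
      have h2 : 0 ≤ P.pairingIn ℤ j k := by
        by_contra! hlt
        rw [RootPairing.pairingIn_lt_zero_iff] at hlt
        omega
      simpa using h2
    obtain ⟨j, hj, hjk⟩ := hk.exists_mem_support_pos_pairingIn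
    have h1 : (0 : ℝ) < P.pairing (highestRoot b) k := by
      rw [pairing_highestRoot]
      refine Finset.sum_pos' (fun j _ => mul_nonneg (Nat.cast_nonneg _) (hnonneg j))
        ⟨⟨j, hj⟩, Finset.mem_univ _, mul_pos (Nat.cast_pos.mpr (mark_pos b _)) ?_⟩
      rw [← P.algebraMap_pairingIn ℤ]
      simpa using hjk
    rw [← P.algebraMap_pairingIn ℤ] at h1
    simpa using h1
  -- θ - k is a root, positive by comparing heights. Hence θ also competes in the maximum and is
  -- strictly higher than `k`, a contradiction.
  obtain ⟨l, hl⟩ := P.root_sub_root_mem_of_pairingIn_pos hpair (Ne.symm hne)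
  have hheight := RootPairing.Base.height_sub b hl
  have hle := height_le_height_highestRoot b k
  have hl0 := b.height_ne_zero l
  have hlpos : b.IsPos l := by
    rw [RootPairing.Base.isPos_iff]
    omega
  have hlx : P.root' l x = P.root' (highestRoot b) x - P.root' k x := by
    rw [RootPairing.root', hl, map_sub, LinearMap.sub_apply]
  have h1 := root'_nonneg_of_isPos hlpos hx
  have h2 := hmax (highestRoot b) ⟨isPos_highestRoot b, by linarith⟩
  rw [RootPairing.Base.isPos_iff] at hlpos
  omega

end HighestRoot

/-! ### The open alcove as a fundamental domain of the affine Weyl group on regular points. -/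

section AffineWeylGroup

variable {ι M N : Type*} [Finite ι] [AddCommGroup M] [Module ℝ M] [AddCommGroup N] [Module ℝ N]
  {P : RootPairing ι ℝ M N} [P.IsRootSystem] [P.IsCrystallographic]

omit [Finite ι] [P.IsRootSystem] [P.IsCrystallographic] in
theorem exists_list_sum_eq_of_mem_corootLattice {x : N} (hx : x ∈ corootLattice P) :
    ∃ l : List ι, (l.map P.coroot).sum = x := by
  induction hx using AddSubgroup.closure_induction with
  | mem x hx =>
    obtain ⟨i, rfl⟩ := hx
    exact ⟨[i], by simp⟩
  | zero => exact ⟨[], rfl⟩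
  | add x y _ _ hx hy =>
    obtain ⟨k, rfl⟩ := hx
    obtain ⟨l, rfl⟩ := hy
    exact ⟨k ++ l, by simp⟩
  | neg x _ hx =>
    obtain ⟨l, rfl⟩ := hx
    refine ⟨l.map fun i => P.reflectionPerm i i, ?_⟩
    rw [List.sum_neg, List.map_map, List.map_map]
    congr 2
    ext i
    simp

omit [Finite ι] [P.IsCrystallographic] in
theorem corootForm_self_pos [Fintype ι] {x : N} (hx : x ≠ 0) : 0 < P.CorootForm x x :=
  P.flip.rootForm_pos_of_ne_zero (by simp) hx

omit [Finite ι] [P.IsCrystallographic] in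
theorem corootForm_coroot_self_pos [Fintype ι] (i : ι) :
    0 < P.CorootForm (P.coroot i) (P.coroot i) :=
  corootForm_self_pos (P.flip.ne_zero i)

-- The coroot form is an invariant form, so α(x) = 2(α^∨, x)/(α^∨, α^∨). This converts root values
-- into changes of length under reflections.
omit [Finite ι] [P.IsRootSystem] [P.IsCrystallographic] in
theorem two_mul_corootForm_coroot [Fintype ι] (i : ι) (x : N) :
    2 * P.CorootForm (P.coroot i) x = P.CorootForm (P.coroot i) (P.coroot i) * P.root' i x := by
  have h := congrArg (fun m => P.toLinearMap m x) (P.corootForm_self_smul_root i)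
  simp only [map_smul, LinearMap.smul_apply, map_nsmul, P.toLinearMap_apply_CoPolarization,
    smul_eq_mul, nsmul_eq_mul, Nat.cast_ofNat] at h
  exact h.symm

omit [Finite ι] [P.IsRootSystem] [P.IsCrystallographic] in
theorem corootForm_sub_smul [Fintype ι] (x y : N) (t : ℝ) :
    P.CorootForm (x - t • y) (x - t • y) =
      P.CorootForm x x - t * (2 * P.CorootForm y x) + t * t * P.CorootForm y y := by
  rw [P.corootForm_apply_apply, P.corootForm_apply_apply, P.corootForm_apply_apply,
    P.corootForm_apply_apply]
  simp only [map_sub, map_smul, smul_eq_mul, Finset.mul_sum, ← Finset.sum_sub_distrib, ← Finset.sum_add_distrib]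
  exact Finset.sum_congr rfl fun i _ => by ring

/-- A vector of the coroot lattice on which all roots take values in `{-1, 0, 1}` is zero. -/
theorem eq_zero_of_mem_corootLattice_of_root'_lt_two {x : N} (hx : x ∈ corootLattice P)
    (h : ∀ i, P.root' i x < 2) : x = 0 := by
  have := Fintype.ofFinite ι
  obtain ⟨l, rfl⟩ := exists_list_sum_eq_of_mem_corootLattice hx
  induction hn : l.length generalizing l with
  | zero => rw [List.length_eq_zero_iff.mp hn]; rfl
  | succ n ih =>
    by_contra hne
    set x := (l.map P.coroot).sum with hxl
    -- Induction on the number of coroots summing to `x`. As (x, x) > 0, some summand pairs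
    -- positively with `x`; by integrality and the bound its root value is exactly 1, so reflecting
    -- deletes that summand.
    have hex : ∃ i ∈ l, 0 < P.root' i x := by
      by_contra! hcon
      have hpos := corootForm_self_pos (P := P) hne
      have hle : ∀ k : List ι, (∀ i ∈ k, P.root' i x ≤ 0) →
          P.CorootForm (k.map P.coroot).sum x ≤ 0 := by
        intro k hk
        induction k with
        | nil => simp
        | cons a t iht =>
          have h1 := iht fun i hi => hk i (by simp [hi])
          have h2 := two_mul_corootForm_coroot (P := P) a x
          have h3 := mul_nonpos_of_nonneg_of_nonpos (corootForm_coroot_self_pos (P := P) a).le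
            (hk a (by simp))
          rw [List.map_cons, List.sum_cons, map_add, LinearMap.add_apply]
          linarith
      exact absurd (hle l hcon) (not_le.mpr hpos)
    obtain ⟨i, hi, hix⟩ := hex
    obtain ⟨s, t, rfl⟩ := List.append_of_mem hi
    have h1 : P.root' i x = 1 := by
      obtain ⟨k, hk⟩ := exists_root'_eq_intCast hx i
      have h2 := h i
      rw [hk] at hix h2 ⊢
      norm_cast at hix h2 ⊢
      omega
    have hy : (((s ++ t).map P.coroot)).sum =
        coweightAction P (RootPairing.weylGroup.ofIdx P i) x := by
      rw [coweightAction_ofIdx, h1, one_smul, hxl]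
      simp only [List.map_append, List.map_cons, List.sum_append, List.sum_cons]
      abel
    have hzero := ih (s ++ t) ?_ ?_ ?_
    · rw [hy] at hzero
      exact hne ((LinearEquiv.map_eq_zero_iff _).mp hzero)
    · rw [hy]
      exact coweightAction_mem_corootLattice _ hx
    · intro j
      rw [hy, root'_coweightAction]
      exact h _
    · simp only [List.length_append, List.length_cons] at hn ⊢
      omega

variable [P.IsReduced] [P.IsIrreducible]

/-- The affine Weyl group acts freely on the points of the open alcove of size `m`. -/
theorem affine_eq_one_of_mem_alcove (b : P.Base) {m : ℕ} {x y : N}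
    (hx : ∀ i ∈ b.support, 0 < P.root' i x) (hxm : P.root' (highestRoot b) x < m)
    (hy : ∀ i ∈ b.support, 0 < P.root' i y) (hym : P.root' (highestRoot b) y < m)
    (w : P.weylGroup) {c : N} (hc : c ∈ corootLattice P)
    (h : y = coweightAction P w x + (m : ℝ) • c) : w = 1 ∧ c = 0 := by
  have hlt {z : N} (hz : ∀ i ∈ b.support, 0 < P.root' i z) (hzm : P.root' (highestRoot b) z < m)
      (i : ι) : P.root' i z < m :=
    (root'_le_root'_highestRoot b i fun j hj => (hz j hj).le).trans_lt hzm
  have hm : (0 : ℝ) < m := (root'_pos_of_isPos (isPos_highestRoot b) hx).trans hxm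
  have hc0 : c = 0 := by
    -- Each root is below `m` at `y` and, through its negative, above `-m` at `x`; hence m * α(c) <
    -- 2m.
    refine eq_zero_of_mem_corootLattice_of_root'_lt_two hc fun i => ?_
    have h1 := hlt hy hym i
    have h2 := hlt hx hxm (P.reflectionPerm (P.weylGroupToPerm w⁻¹ i) (P.weylGroupToPerm w⁻¹ i))
    rw [root'_reflectionPerm_self] at h2
    rw [h, map_add, root'_coweightAction, map_smul, smul_eq_mul] at h1
    have h3 : (m : ℝ) * P.root' i c < m * 2 := by linarith
    exact lt_of_mul_lt_mul_left h3 hm.le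
  refine ⟨?_, hc0⟩
  rw [hc0, smul_zero, add_zero] at h
  rw [← inv_eq_one]
  refine eq_one_of_forall_isPos b _ fun i hi => ?_
  rw [isPos_iff_root'_pos hx, ← root'_coweightAction, ← h]
  exact root'_pos_of_isPos hi hy

omit [P.IsReduced] in
/-- Every regular integral point can be moved into the open alcove of size `m` by the affine
Weyl group. -/
theorem exists_affine_mem_alcove (b : P.Base) {m : ℕ} {d x : N}
    (hdL : d ∈ coweightLattice b) (hd : ∀ i ∈ b.support, 0 < P.root' i d)
    (hdm : P.root' (highestRoot b) d < m) (hxL : x ∈ coweightLattice b)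
    (hreg : ∀ i, ∀ k : ℤ, P.root' i x ≠ m * k) :
    ∃ w : P.weylGroup, ∃ c ∈ corootLattice P,
      (∀ i ∈ b.support, 0 < P.root' i (coweightAction P w x + (m : ℝ) • c)) ∧
      P.root' (highestRoot b) (coweightAction P w x + (m : ℝ) • c) < m := by
  have := Fintype.ofFinite ι
  let F : P.weylGroup × corootLattice P → N :=
    fun p => coweightAction P p.1 x + (m : ℝ) • (p.2 : N)
  -- The squared distance is a sum of squares of root values, which are integers here, so a minimum
  -- over the infinite orbit exists.
  have hint : ∀ p, ∃ n : ℕ, P.CorootForm (F p - d) (F p - d) = n := by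
    intro p
    have hmem : F p - d ∈ coweightLattice b := by
      refine sub_mem (add_mem (coweightAction_mem_coweightLattice _ hxL) ?_) hdL
      rw [Nat.cast_smul_eq_nsmul]
      exact nsmul_mem (corootLattice_le_coweightLattice b p.2.2) _
    choose k hk using exists_root'_eq_intCast_of_mem_coweightLattice hmem
    refine ⟨(∑ i, k i * k i).toNat, ?_⟩
    rw [P.corootForm_apply_apply]
    simp only [hk]
    have h0 : 0 ≤ ∑ i, k i * k i := Finset.sum_nonneg fun i _ => mul_self_nonneg _
    have h1 : (((∑ i, k i * k i).toNat : ℤ) : ℝ) = ((∑ i, k i * k i : ℤ) : ℝ) := by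
      rw [Int.toNat_of_nonneg h0]
    rw [Int.cast_natCast] at h1
    rw [h1]
    push_cast
    rfl
  choose n hn using hint
  obtain ⟨p, hp⟩ : ∃ p, ∀ p', n p ≤ n p' := by
    obtain ⟨p, -, hp⟩ := WellFounded.has_min (InvImage.wf n (wellFounded_lt (α := ℕ))) Set.univ
      ⟨(1, 0), trivial⟩
    exact ⟨p, fun p' => not_lt.mp (hp p' trivial)⟩
  have hne : ∀ i, ∀ k : ℤ, P.root' i (F p) - m * k ≠ 0 := by
    intro i k h
    obtain ⟨l, hl⟩ := exists_root'_eq_intCast p.2.2 i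
    apply hreg (P.weylGroupToPerm p.1⁻¹ i) (k - l)
    simp only [F, map_add, map_smul, root'_coweightAction, smul_eq_mul, hl] at h
    push_cast
    linarith
  -- Reflecting in the wall α = mk stays in the orbit and cannot come closer to `d`; so the nearest
  -- orbit point is on the same side of that wall as `d`. Only the walls αᵢ = 0 and θ = m are needed
  -- below.
  have key : ∀ i, ∀ k : ℤ, 0 ≤ (P.root' i (F p) - m * k) * (P.root' i d - m * k) := by
    intro i k
    let s := RootPairing.weylGroup.ofIdx P i
    let p' : P.weylGroup × corootLattice P := (s * p.1,
      ⟨coweightAction P s p.2 + k • P.coroot i, add_mem (coweightAction_mem_corootLattice _ p.2.2)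
        (zsmul_mem (coroot_mem_corootLattice P i) _)⟩)
    have hF : F p' - d = (F p - d) - (P.root' i (F p) - m * k) • P.coroot i := by
      have h1 : F p' = coweightAction P s (F p) + ((m : ℝ) * k) • P.coroot i := by
        simp only [F, p', map_mul, LinearEquiv.mul_apply, map_add, map_smul, smul_add, mul_smul,
          Int.cast_smul_eq_zsmul]
        abel
      rw [h1, coweightAction_ofIdx, sub_smul]
      abel
    have hle : P.CorootForm (F p - d) (F p - d) ≤ P.CorootForm (F p' - d) (F p' - d) := by
      rw [hn, hn]
      exact_mod_cast hp p'
    rw [hF] at hle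
    have h2 := two_mul_corootForm_coroot (P := P) i (F p - d)
    have h3 := corootForm_coroot_self_pos (P := P) i
    rw [corootForm_sub_smul] at hle
    rw [h2, map_sub (P.root' i)] at hle
    refine nonneg_of_mul_nonneg_left (b := P.CorootForm (P.coroot i) (P.coroot i)) ?_ h3
    linear_combination hle
  refine ⟨p.1, p.2, p.2.2, fun i hi => ?_, ?_⟩
  · have h1 := key i 0
    have h2 := hne i 0
    simp only [Int.cast_zero, mul_zero, sub_zero] at h1 h2
    exact (nonneg_of_mul_nonneg_left h1 (hd i hi)).lt_of_ne' h2
  · have h1 := key (highestRoot b) 1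
    have h2 := hne (highestRoot b) 1
    simp only [Int.cast_one, mul_one] at h1 h2
    have h3 : P.root' (highestRoot b) (F p) - m ≤ 0 := by
      by_contra! h
      have := mul_neg_of_pos_of_neg h (sub_neg.mpr hdm)
      linarith
    exact sub_neg.mp (h3.lt_of_ne h2)

end AffineWeylGroup

/-! ### Integral coordinates on the coweight lattice and indices of scaled lattices. -/

section Coordinates

variable {ι M N : Type*} [AddCommGroup M] [Module ℝ M] [AddCommGroup N] [Module ℝ N]
  {P : RootPairing ι ℝ M N} [P.IsRootSystem]

/-- The linear coordinates on `N` given by the values of the simple roots. -/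
noncomputable def simpleCoords (b : P.Base) : N ≃ₗ[ℝ] (b.support → ℝ) :=
  P.flip.toPerfPair ≪≫ₗ (b.toWeightBasis.constr ℝ).symm

theorem simpleCoords_apply (b : P.Base) (x : N) (i : b.support) :
    simpleCoords b x i = P.root' i x := by
  have h : (b.toWeightBasis.constr ℝ) (simpleCoords b x) = P.flip.toPerfPair x := by
    simp [simpleCoords]
  have h2 := congrArg (fun φ => φ (b.toWeightBasis i)) h
  simp only [Basis.constr_basis] at h2
  rw [h2, b.toWeightBasis_apply]
  rfl

theorem exists_root'_eq (b : P.Base) (f : b.support → ℝ) :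
    ∃ x : N, ∀ i : b.support, P.root' i x = f i :=
  ⟨(simpleCoords b).symm f, fun i => by rw [← simpleCoords_apply, LinearEquiv.apply_symm_apply]⟩

theorem eq_of_forall_root'_eq (b : P.Base) {x y : N}
    (h : ∀ i : b.support, P.root' i x = P.root' i y) : x = y := by
  apply (simpleCoords b).injective
  ext i
  rw [simpleCoords_apply, simpleCoords_apply, h]

/-- The values of the simple roots on the coweight lattice. -/
noncomputable def integralCoords (b : P.Base) : coweightLattice b →+ (b.support → ℤ) where
  toFun x i := ⌊P.root' i (x : N)⌋
  map_zero' := by ext; simp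
  map_add' x y := by
    ext i
    obtain ⟨k, hk⟩ := x.2 i i.2
    obtain ⟨l, hl⟩ := y.2 i i.2
    simp [hk, hl]

omit [P.IsRootSystem] in
theorem integralCoords_cast (b : P.Base) (x : coweightLattice b) (i : b.support) :
    (integralCoords b x i : ℝ) = P.root' i (x : N) := by
  obtain ⟨k, hk⟩ := x.2 i i.2
  change ((⌊P.root' i (x : N)⌋ : ℤ) : ℝ) = _
  rw [hk, Int.floor_intCast]

theorem integralCoords_injective (b : P.Base) : Function.Injective (integralCoords b) := by
  intro x y h
  refine Subtype.ext (eq_of_forall_root'_eq b fun i => ?_)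
  rw [← integralCoords_cast, ← integralCoords_cast, h]

theorem integralCoords_surjective (b : P.Base) : Function.Surjective (integralCoords b) := by
  intro f
  obtain ⟨x, hx⟩ := exists_root'_eq b fun i => (f i : ℝ)
  refine ⟨⟨x, fun i hi => ⟨f ⟨i, hi⟩, hx ⟨i, hi⟩⟩⟩, ?_⟩
  ext i
  have := integralCoords_cast b ⟨x, fun i hi => ⟨f ⟨i, hi⟩, hx ⟨i, hi⟩⟩⟩ i
  rw [hx] at this
  exact_mod_cast this

theorem relIndex_nsmul_coweightLattice (b : P.Base) (q : ℕ) :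
    ((coweightLattice b).map (nsmulAddMonoidHom q)).relIndex (coweightLattice b) =
      q ^ finrank ℝ M := by
  -- Reduction of coordinates mod `q` is onto with kernel the `q`-fold multiples of the lattice.
  let φ : coweightLattice b →+ (b.support → ZMod q) :=
    ((Int.castAddHom (ZMod q)).compLeft b.support).comp (integralCoords b)
  have hφ (x : coweightLattice b) (i : b.support) : φ x i = (integralCoords b x i : ZMod q) := rfl
  have hker : ((coweightLattice b).map (nsmulAddMonoidHom q)).addSubgroupOf (coweightLattice b) =
      φ.ker := by
    ext x
    rw [AddSubgroup.mem_addSubgroupOf, AddMonoidHom.mem_ker]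
    constructor
    · rintro ⟨y, hy, hyx⟩
      have hx : x = q • (⟨y, hy⟩ : coweightLattice b) := Subtype.ext hyx.symm
      ext i
      rw [hφ, hx, map_nsmul]
      simp
    · intro h
      have hdvd : ∀ i, (q : ℤ) ∣ integralCoords b x i := fun i =>
        (ZMod.intCast_zmod_eq_zero_iff_dvd _ _).mp (congrFun h i)
      choose g hg using hdvd
      obtain ⟨y, hy⟩ := integralCoords_surjective b g
      refine ⟨y, y.2, ?_⟩
      have hxy : q • y = x := by
        apply integralCoords_injective b
        ext i
        rw [map_nsmul, hy, hg]
        simp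
      rw [← hxy]
      rfl
  have hsurj : Function.Surjective φ := by
    intro f
    choose g hg using fun i => ZMod.intCast_surjective (f i)
    obtain ⟨x, hx⟩ := integralCoords_surjective b g
    exact ⟨x, by ext i; rw [hφ, hx, hg]⟩
  rw [AddSubgroup.relIndex, hker, AddSubgroup.index_ker, AddMonoidHom.range_eq_top.mpr hsurj,
    finrank_eq_card_basis b.toWeightBasis]
  simp [Nat.card_eq_fintype_card, Nat.card_fun]

theorem relIndex_nsmul_corootLattice [P.IsCrystallographic] (b : P.Base) {q : ℕ} (hq : q ≠ 0) :
    ((corootLattice P).map (nsmulAddMonoidHom q)).relIndex (coweightLattice b) =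
      connectionIndex b * q ^ finrank ℝ M := by
  have hinj : Function.Injective (nsmulAddMonoidHom q : N →+ N) := by
    have : IsAddTorsionFree N := .of_isTorsionFree ℝ N
    exact nsmul_right_injective hq
  rw [← AddSubgroup.relIndex_mul_relIndex _ _ _
    (AddSubgroup.map_mono (f := nsmulAddMonoidHom q) (corootLattice_le_coweightLattice b)) ?_,
    relIndex_nsmul_coweightLattice, AddSubgroup.relIndex_map_map_of_injective _ _ hinj,
    connectionIndex]
  rintro _ ⟨x, hx, rfl⟩
  exact nsmul_mem hx q

end Coordinates

/-! ### Lattice points in half-open alcoves and the bijection with residue classes. -/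

section Counting

variable {ι M N : Type*} [Finite ι] [AddCommGroup M] [Module ℝ M] [AddCommGroup N] [Module ℝ N]
  {P : RootPairing ι ℝ M N} [P.IsRootSystem] [P.IsIrreducible]

/-- The indices of the roots `affineSimpleRoot b i`. -/
noncomputable def affineIdx (b : P.Base) : Option b.support → ι
  | none => P.reflectionPerm (highestRoot b) (highestRoot b)
  | some i => i

theorem root_affineIdx (b : P.Base) (i : Option b.support) :
    P.root (affineIdx b i) = affineSimpleRoot b i := by
  cases i with
  | none => simp [affineIdx, affineSimpleRoot]
  | some i => rfl

theorem isPositiveRoot_smul_affineSimpleRoot (b : P.Base) (w : P.weylGroup)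
    (i : Option b.support) :
    IsPositiveRoot b (w • affineSimpleRoot b i) ↔ b.IsPos (P.weylGroupToPerm w (affineIdx b i)) := by
  rw [← root_affineIdx, P.weylGroup_apply_root]
  constructor
  · rintro ⟨j, hj, h⟩
    rwa [← P.root.injective h]
  · exact fun h => ⟨_, h, rfl⟩

/-- The barycentric coordinates on the alcove of size `n`. -/
noncomputable def affineCoord (b : P.Base) (n : ℝ) (i : Option b.support) (x : N) : ℝ :=
  P.root' (affineIdx b i) x + i.elim n fun _ => 0

theorem affineCoord_none (b : P.Base) (n : ℝ) (x : N) :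
    affineCoord b n none x = n - P.root' (highestRoot b) x := by
  rw [affineCoord, affineIdx, root'_reflectionPerm_self, Option.elim_none]
  ring

theorem affineCoord_some (b : P.Base) (n : ℝ) (i : b.support) (x : N) :
    affineCoord b n (some i) x = P.root' i x := by
  rw [affineCoord, affineIdx, Option.elim_some, add_zero]

theorem sum_affineMark_mul_affineCoord (b : P.Base) (n : ℝ) (x : N) :
    ∑ i, affineMark b i * affineCoord b n i x = n := by
  rw [Fintype.sum_option, affineCoord_none, root'_highestRoot]
  simp [affineCoord_some, affineMark]

/-- The points of the coweight lattice whose barycentric coordinates in the alcove of size `n`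
are at least `s`. -/
def latticePoints (b : P.Base) (s : Option b.support → ℕ) (n : ℝ) : Set N :=
  {x | x ∈ coweightLattice b ∧ ∀ i, s i ≤ affineCoord b n i x}

/-- Translation by a coweight with prescribed simple root values absorbs the bounds at the simple
roots. The change of size absorbs the bound at α₀, because c₀ = 1. -/
theorem latticePoints_eq_image (b : P.Base) (s : Option b.support → ℕ) (n : ℝ) :
    ∃ x : N, latticePoints b s n =
      (fun y => y + x) '' latticePoints b 0 (n - ∑ i, affineMark b i * s i) := by
  obtain ⟨x, hx⟩ := exists_root'_eq b fun i => (s (some i) : ℝ)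
  have hxL : x ∈ coweightLattice b := fun i hi => ⟨s (some ⟨i, hi⟩), by simpa using hx ⟨i, hi⟩⟩
  have hcoord (y : N) (i : Option b.support) :
      affineCoord b (n - ∑ i, affineMark b i * s i) i y + s i = affineCoord b n i (y + x) := by
    cases i with
    | none =>
      rw [affineCoord_none, affineCoord_none, map_add, root'_highestRoot b x, Fintype.sum_option]
      simp only [hx, affineMark]
      push_cast
      ring
    | some i => rw [affineCoord_some, affineCoord_some, map_add, hx]
  refine ⟨x, ?_⟩
  ext y
  constructor
  · rintro ⟨hy, h⟩
    refine ⟨y - x, ⟨sub_mem hy hxL, fun i => ?_⟩, by simp⟩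
    have := hcoord (y - x) i
    rw [sub_add_cancel] at this
    have h1 := h i
    simp only [Pi.zero_apply, Nat.cast_zero]
    linarith
  · rintro ⟨z, ⟨hz, h⟩, rfl⟩
    refine ⟨add_mem hz hxL, fun i => ?_⟩
    have h1 := h i
    simp only [Pi.zero_apply, Nat.cast_zero] at h1
    change (s i : ℝ) ≤ affineCoord b n i (z + x)
    rw [← hcoord]
    linarith

theorem ncard_latticePoints (b : P.Base) (s : Option b.support → ℕ) (n : ℝ) :
    (latticePoints b s n).ncard =
      (latticePoints b 0 (n - ∑ i, affineMark b i * s i)).ncard := by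
  obtain ⟨x, hx⟩ := latticePoints_eq_image b s n
  rw [hx, Set.ncard_image_of_injective _ (add_left_injective x)]

variable [P.IsCrystallographic] [P.IsReduced]

theorem root'_le_of_affineCoord_nonneg (b : P.Base) {n : ℝ} {x : N}
    (h : ∀ i, 0 ≤ affineCoord b n i x) (i : ι) : P.root' i x ≤ n := by
  have h1 := root'_le_root'_highestRoot b i (x := x) fun j hj => by
    simpa [affineCoord_some] using h (some ⟨j, hj⟩)
  have h2 := h none
  rw [affineCoord_none] at h2
  linarith

theorem finite_latticePoints (b : P.Base) (s : Option b.support → ℕ) (n : ℝ) :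
    (latticePoints b s n).Finite := by
  classical
  refine Set.Finite.subset (((Set.finite_Icc (0 : b.support → ℤ)
    (fun _ => ⌊n⌋)).preimage (integralCoords_injective b).injOn).image Subtype.val) ?_
  rintro x ⟨hx, h⟩
  have h0 : ∀ i, 0 ≤ affineCoord b n i x := fun i => (Nat.cast_nonneg _).trans (h i)
  refine ⟨⟨x, hx⟩, ⟨fun i => ?_, fun i => ?_⟩, rfl⟩
  · have h1 := h0 (some i)
    rw [affineCoord_some, ← integralCoords_cast b ⟨x, hx⟩] at h1
    exact_mod_cast h1
  · rw [Int.le_floor, integralCoords_cast]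
    exact root'_le_of_affineCoord_nonneg b h0 i

theorem smul_closedAlcove (b : P.Base) {n : ℝ} (hn : 0 ≤ n) :
    n • closedAlcove b = {x | ∀ i, 0 ≤ affineCoord b n i x} := by
  have hiff (m : ℝ) (x : N) : (∀ i, 0 ≤ affineCoord b m i x) ↔
      (∀ i ∈ b.support, 0 ≤ P.root' i x) ∧ P.root' (highestRoot b) x ≤ m := by
    simp [Option.forall, affineCoord_none, affineCoord_some, and_comm]
  rcases hn.eq_or_lt with rfl | hn
  -- Size 0 is separate, since scaling is not invertible: both sides reduce to the origin.
  · rw [Set.zero_smul_set ⟨0, by simp [closedAlcove]⟩]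
    ext x
    simp only [Set.mem_zero, Set.mem_ofPred_eq]
    constructor
    · rintro rfl
      rw [hiff]
      simp
    · intro h
      refine eq_of_forall_root'_eq b fun i => ?_
      rw [map_zero]
      refine le_antisymm (root'_le_of_affineCoord_nonneg b h i) ?_
      simpa [affineCoord_some] using h (some i)
  · ext x
    rw [Set.mem_smul_set_iff_inv_smul_mem₀ hn.ne', Set.mem_ofPred_eq, hiff]
    simp [closedAlcove, hn, inv_mul_le_iff₀]

theorem ehrhart_eq_ncard (b : P.Base) (n : ℤ) : ehrhart b n = (latticePoints b 0 n).ncard := by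
  rw [ehrhart]
  split_ifs with hn
  · rw [smul_closedAlcove b (by exact_mod_cast hn)]
    congr 2
    ext x
    simp [latticePoints, and_comm]
  -- The weighted sum of the coordinates is `n`, so nonnegative coordinates are impossible for
  -- negative `n`. This matches the convention L(n) = 0.
  · have : latticePoints b 0 (n : ℝ) = ∅ := by
      refine Set.eq_empty_of_forall_notMem fun x hx => hn ?_
      have h := sum_affineMark_mul_affineCoord b (n : ℝ) x
      have h0 : (0 : ℝ) ≤ n := by
        rw [← h]
        exact Finset.sum_nonneg fun i _ =>
          mul_nonneg (Nat.cast_nonneg _) (by simpa using hx.2 i)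
      exact_mod_cast h0
    rw [this]
    simp

open Classical in
/-- The indicator of the affine simple roots which `w` sends to positive roots. -/
noncomputable def ascents (b : P.Base) (w : P.weylGroup) (i : Option b.support) : ℕ :=
  if b.IsPos (P.weylGroupToPerm w (affineIdx b i)) then 1 else 0

omit [P.IsCrystallographic] [P.IsReduced] in
theorem asc_eq_sum (b : P.Base) (w : P.weylGroup) :
    asc b w = ∑ i, affineMark b i * ascents b w i := by
  classical
  simp only [asc, ascents, mul_ite, mul_one, mul_zero]
  exact Finset.sum_congr rfl fun i _ =>
    if_congr (isPositiveRoot_smul_affineSimpleRoot b w i) rfl rfl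

theorem ncard_latticePoints_ascents (b : P.Base) (w : P.weylGroup) (n : ℤ) :
    ((latticePoints b (ascents b w) n).ncard : ℚ) = ehrhart b (n - asc b w) := by
  rw [ehrhart_eq_ncard, ncard_latticePoints, asc_eq_sum]
  push_cast
  rfl

omit [P.IsCrystallographic] [P.IsReduced] in
theorem abs_height_le (b : P.Base) (i : ι) : |b.height i| ≤ b.height (highestRoot b) := by
  let _ := P.indexNeg
  have h1 := height_le_height_highestRoot b i
  have h2 := height_le_height_highestRoot b (-i)
  rw [b.height_reflectionPerm_self] at h2
  exact abs_le.mpr ⟨by omega, h1⟩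

omit [P.IsCrystallographic] [P.IsReduced] in
/-- A multiple of a lattice point, moved slightly into the direction `-w⁻¹ d` with `d` strictly
dominant, lies in the open alcove of size `k * n` if and only if the lattice point lies in the
half-open alcove of size `n` given by the ascents of `w`. -/
theorem mem_latticePoints_ascents_iff (b : P.Base) (w : P.weylGroup) {d x : N} {k : ℕ}
    (hd : ∀ i ∈ b.support, P.root' i d = 1) (hk : b.height (highestRoot b) < k)
    (hx : x ∈ coweightLattice b) (n : ℕ) :
    x ∈ latticePoints b (ascents b w) n ↔
      ∀ i, 0 < affineCoord b ((k * n : ℕ) : ℝ) i ((k : ℝ) • x - coweightAction P w⁻¹ d) := by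
  have hiff : x ∈ latticePoints b (ascents b w) n ↔
      ∀ i, (ascents b w i : ℝ) ≤ affineCoord b n i x := and_iff_right hx
  rw [hiff]
  refine forall_congr' fun i => ?_
  obtain ⟨c, hc⟩ : ∃ c : ℤ, affineCoord b n i x = c := by
    obtain ⟨l, hl⟩ := exists_root'_eq_intCast_of_mem_coweightLattice hx (affineIdx b i)
    cases i with
    | none => exact ⟨l + n, by simp [affineCoord, hl]⟩
    | some i => exact ⟨l, by simp [affineCoord, hl]⟩
  -- An integral coordinate `c` becomes k c - ht(w αᵢ) with 0 < |ht| < k. It is positive iff c ≥ 1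
  -- when w αᵢ > 0, and iff c ≥ 0 otherwise.
  have hcoord : affineCoord b ((k * n : ℕ) : ℝ) i ((k : ℝ) • x - coweightAction P w⁻¹ d) =
      ((k * c - b.height (P.weylGroupToPerm w (affineIdx b i)) : ℤ) : ℝ) := by
    push_cast
    rw [← root'_eq_height hd, root'_weylGroupToPerm, ← hc, affineCoord, affineCoord, map_sub,
      map_smul, smul_eq_mul]
    cases i with
    | none =>
      simp
      ring
    | some i => simp
  rw [hcoord, hc]
  have h1 := abs_le.mp (abs_height_le b (P.weylGroupToPerm w (affineIdx b i)))
  have hk0 : (0 : ℤ) < k := by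
    have := (RootPairing.Base.isPos_iff b).mp (isPos_highestRoot b)
    omega
  by_cases hpos : b.IsPos (P.weylGroupToPerm w (affineIdx b i))
  · rw [ascents, if_pos hpos]
    rw [RootPairing.Base.isPos_iff] at hpos
    norm_cast
    constructor
    · intro h
      nlinarith
    · intro h
      by_contra! hcon
      nlinarith
  · rw [ascents, if_neg hpos]
    rw [RootPairing.Base.isPos_iff'] at hpos
    norm_cast
    constructor
    · intro h
      nlinarith
    · intro h
      by_contra! hcon
      nlinarith

/-- The half-open alcoves attached to the elements of the Weyl group form a fundamental domain
for the translations by the `n`-fold multiples of the coroot lattice. -/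
theorem bijective_mk_coweightAction (b : P.Base) {n : ℕ} (hn : n ≠ 0) :
    Function.Bijective fun p : Σ w : P.weylGroup, latticePoints b (ascents b w) (n : ℝ) =>
      (QuotientAddGroup.mk ⟨coweightAction P p.1 p.2,
        coweightAction_mem_coweightLattice p.1 p.2.2.1⟩ : coweightLattice b ⧸
          ((corootLattice P).map (nsmulAddMonoidHom n)).addSubgroupOf (coweightLattice b)) := by
  obtain ⟨d, hd'⟩ := exists_root'_eq b fun _ => (1 : ℝ)
  have hd : ∀ i ∈ b.support, P.root' i d = 1 := fun i hi => hd' ⟨i, hi⟩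
  have hdL : d ∈ coweightLattice b := fun i hi => ⟨1, by simpa using hd i hi⟩
  have hθ := (RootPairing.Base.isPos_iff b).mp (isPos_highestRoot b)
  obtain ⟨k, hk⟩ : ∃ k : ℕ, (k : ℤ) = b.height (highestRoot b) + 1 :=
    ⟨(b.height (highestRoot b) + 1).toNat, Int.toNat_of_nonneg (by omega)⟩
  have hk1 : b.height (highestRoot b) < k := by omega
  have hk0 : (k : ℝ) ≠ 0 := by
    have : k ≠ 0 := by omega
    exact_mod_cast this
  have hn0 : (n : ℝ) ≠ 0 := by exact_mod_cast hn
  have halcove {z : N} : (∀ i, 0 < affineCoord b ((k * n : ℕ) : ℝ) i z) ↔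
      (∀ i ∈ b.support, 0 < P.root' i z) ∧ P.root' (highestRoot b) z < ((k * n : ℕ) : ℝ) := by
    simp [Option.forall, affineCoord_none, affineCoord_some, and_comm]
  constructor
  · rintro ⟨w, x, hx⟩ ⟨u, y, hy⟩ h
    obtain ⟨c, hc, h⟩ := AddSubgroup.mem_addSubgroupOf.mp (QuotientAddGroup.eq.mp h)
    replace h : coweightAction P u y = coweightAction P w x + (n : ℝ) • c := by
      have h' : n • c = -coweightAction P w x + coweightAction P u y := h
      rw [Nat.cast_smul_eq_nsmul, h']
      abel
    have hinv (v : P.weylGroup) (t : N) : coweightAction P v⁻¹ (coweightAction P v t) = t := by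
      rw [← LinearEquiv.mul_apply, ← map_mul, inv_mul_cancel, map_one]
      rfl
    have hx' := halcove.mp ((mem_latticePoints_ascents_iff b w hd hk1 hx.1 n).mp hx)
    have hy' := halcove.mp ((mem_latticePoints_ascents_iff b u hd hk1 hy.1 n).mp hy)
    -- Freeness is applied to the perturbed points: k y - u⁻¹ d = u⁻¹ w (k x - w⁻¹ d) + k n u⁻¹ c.
    obtain ⟨h1, h2⟩ := affine_eq_one_of_mem_alcove b hx'.1 hx'.2 hy'.1 hy'.2 (u⁻¹ * w)
      (coweightAction_mem_corootLattice u⁻¹ hc) (by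
        have h3 : y = coweightAction P u⁻¹ (coweightAction P w x) +
            (n : ℝ) • coweightAction P u⁻¹ c := by
          rw [← map_smul, ← map_add, ← h, hinv]
        have h4 : coweightAction P w (coweightAction P w⁻¹ d) = d := by
          rw [← LinearEquiv.mul_apply, ← map_mul, mul_inv_cancel, map_one]
          rfl
        rw [map_mul, LinearEquiv.mul_apply, map_sub, map_sub, h4, map_smul, map_smul]
        nth_rewrite 1 [h3]
        rw [Nat.cast_mul, mul_smul, smul_add]
        abel)
    have hwu : u = w := inv_mul_eq_one.mp h1
    subst hwu
    rw [LinearEquiv.map_eq_zero_iff] at h2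
    rw [h2, smul_zero, add_zero] at h
    obtain rfl : y = x := (coweightAction P u).injective h
    rfl
  · intro t
    induction t using QuotientAddGroup.induction_on with
    | H x =>
    obtain ⟨x, hx⟩ := x
    -- The point k x - d is regular: `k` divides no height. Moving it into the alcove gives k (u x +
    -- n c) - u d, so u x + n c lies in the half-open alcove of u⁻¹, and u⁻¹ sends it back to the
    -- class of `x`.
    obtain ⟨u, c, hc, hz⟩ := exists_affine_mem_alcove b (m := k * n) (x := (k : ℝ) • x - d) hdL
      (fun i hi => by rw [hd i hi]; exact one_pos) (by
        rw [root'_eq_height hd]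
        have h1 : b.height (highestRoot b) < ((k * n : ℕ) : ℤ) := by
          have h2 : k ≤ k * n := Nat.le_mul_of_pos_right k (Nat.pos_of_ne_zero hn)
          omega
        exact_mod_cast h1)
      (sub_mem (by rw [Nat.cast_smul_eq_nsmul]; exact nsmul_mem hx k) hdL) (by
        intro i l h
        obtain ⟨j, hj⟩ := exists_root'_eq_intCast_of_mem_coweightLattice hx i
        rw [map_sub, map_smul, root'_eq_height hd, hj, smul_eq_mul] at h
        have h1 : (k : ℤ) * j - b.height i = (k * n : ℕ) * l := by exact_mod_cast h
        have h2 : (k : ℤ) ∣ b.height i := ⟨j - n * l, by push_cast at h1; linarith⟩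
        have h3 := Int.le_of_dvd (abs_pos.mpr (b.height_ne_zero i)) ((dvd_abs _ _).mpr h2)
        have h4 := abs_height_le b i
        omega)
    have hyL : coweightAction P u x + (n : ℝ) • c ∈ coweightLattice b := by
      refine add_mem (coweightAction_mem_coweightLattice u hx) ?_
      rw [Nat.cast_smul_eq_nsmul]
      exact nsmul_mem (corootLattice_le_coweightLattice b hc) n
    have hy := (mem_latticePoints_ascents_iff b u⁻¹ hd hk1 hyL n).mpr (by
      rw [inv_inv]
      convert halcove.mpr hz using 3
      rw [map_sub, map_smul, Nat.cast_mul, mul_smul, smul_add]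
      abel)
    refine ⟨⟨u⁻¹, _, hy⟩, ?_⟩
    refine (QuotientAddGroup.eq.mpr ?_).symm
    rw [AddSubgroup.mem_addSubgroupOf]
    refine ⟨coweightAction P u⁻¹ c, coweightAction_mem_corootLattice _ hc, ?_⟩
    change n • coweightAction P u⁻¹ c =
      -x + coweightAction P u⁻¹ (coweightAction P u x + (n : ℝ) • c)
    rw [map_add, ← LinearEquiv.mul_apply, ← map_mul, inv_mul_cancel, map_one, map_smul,
      Nat.cast_smul_eq_nsmul]
    simp

/-- The count of the lattice points in all half-open alcoves of size `n`. -/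
theorem connectionIndex_mul_pow (b : P.Base) [Fintype P.weylGroup] {n : ℕ} (hn : n ≠ 0) :
    connectionIndex b * n ^ finrank ℝ M =
      ∑ w : P.weylGroup, (latticePoints b (ascents b w) n).ncard := by
  have (w : P.weylGroup) : Finite (latticePoints b (ascents b w) n) := finite_latticePoints b _ _
  rw [← relIndex_nsmul_corootLattice b hn]
  have h := Nat.card_eq_of_bijective _ (bijective_mk_coweightAction b hn)
  rw [Nat.card_sigma] at h
  exact h.symm

/-- At size 1 the bijection exhibits Z/Q as the image of a finite set; this permits division by f.
-/
theorem connectionIndex_ne_zero (b : P.Base) : connectionIndex b ≠ 0 := by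
  have (w : P.weylGroup) : Finite (latticePoints b (ascents b w) ((1 : ℕ) : ℝ)) :=
    finite_latticePoints b _ _
  have hfin := Finite.of_surjective _ (bijective_mk_coweightAction b one_ne_zero).surjective
  have h := relIndex_nsmul_corootLattice b one_ne_zero
  rw [one_pow, mul_one] at h
  rw [← h]
  exact Nat.card_ne_zero.mpr ⟨⟨0⟩, hfin⟩

end Counting

end Worpitzky

theorem theorem3p7 {ι M N : Type*} [Finite ι] [AddCommGroup M] [Module ℝ M]
    [AddCommGroup N] [Module ℝ N] (P : RootPairing ι ℝ M N)
    [P.IsRootSystem] [P.IsCrystallographic] [P.IsReduced] [P.IsIrreducible]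
    (b : P.Base) (q : ℕ) (hq : Worpitzky.coxeterNumber b < q) :
    (q : ℚ) ^ Module.finrank ℝ M =
      Polynomial.aeval Worpitzky.shift (Worpitzky.generalizedEulerian b)
        (Worpitzky.ehrhart b) (q : ℤ) := by
  have := Fintype.ofFinite P.weylGroup
  have hf : (Worpitzky.connectionIndex b : ℚ) ≠ 0 := by
    exact_mod_cast Worpitzky.connectionIndex_ne_zero b
  have h : (Worpitzky.connectionIndex b : ℚ) * (q : ℚ) ^ Module.finrank ℝ M =
      ∑ w : P.weylGroup, Worpitzky.ehrhart b ((q : ℤ) - Worpitzky.asc b w) := by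
    simp only [← Worpitzky.ncard_latticePoints_ascents]
    exact_mod_cast Worpitzky.connectionIndex_mul_pow b (Nat.ne_zero_of_lt hq)
  rw [Worpitzky.generalizedEulerian, finsum_eq_sum_of_fintype, map_mul, map_sum,
    Polynomial.aeval_C, Module.End.mul_apply, Module.algebraMap_end_apply, Pi.smul_apply,
    LinearMap.sum_apply, Finset.sum_apply]
  simp only [map_pow, Polynomial.aeval_X, Worpitzky.shift_pow_apply]
  rw [← h, smul_eq_mul, inv_mul_cancel_left₀ hf]
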